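/- Let $C(2^{\mathbb N})$ be the Banach space of real continuous functions on the Cantor space with the supremum norm, and let $SB$ be the set of closed linear subspaces of $C(2^{\mathbb N})$ with the relative Effros–Borel $\sigma$-algebra, generated by the sets $\{X\in SB: X\cap U\neq\emptyset\}$, $U\subset C(2^{\mathbb N})$ open. Call a sequence of Borel maps $d_n\colon SB\to C(2^{\mathbb N})$, $n\in\mathbb N$, a *ball selection* if for every $X\in SB$ (with closed unit ball $B_X$): $(d_n(X))_n$ is a dense sequence in $B_X$; whenever $p,q\in\mathbb Q$, $m,k\in\mathbb N$ and $q\,d_m(X)+p\,d_k(X)\in B_X\setminus\{0\}$, there is $\ell\in\mathbb N$ with $d_\ell(X)=q\,d_m(X)+p\,d_k(X)$; and $d_n(X)\neq 0$ for all $n$ if $X\neq\{0\}$. Given a ball selection $(d_n)$ and $X,Y\in SB$, let $\mathcal C_{X,Y}$ be the set of all $(w_k)_k\in C(2^{\mathbb N})^{\mathbb N}$ such that $w_k\in Y$ for all $k$; for all $n,m,l\in\mathbb N$ and $q,p\in\mathbb Q$, $d_n(X)=q\,d_m(X)+p\,d_l(X)$ implies $w_n=q\,w_m+p\,w_l$;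 and there is $K\in\mathbb N$ with $\|\sum_i a_iw_i\|\le K\|\sum_i a_id_i(X)\|$ for all finitely supported rational sequences $(a_i)$. For $(w_k)\in\mathcal C_{X,Y}$ there is a unique bounded linear operator $T\colon X\to Y$ with $Td_k(X)=w_k$ for all $k$. Let $$\mathcal L=\{(X,Y,(w_k))\in SB\times SB\times C(2^{\mathbb N})^{\mathbb N}: (w_k)\in\mathcal C_{X,Y}\}.$$ A subset of a measurable space is *analytic* if it is the image of a Polish space under a Borel map, and *coanalytic* if its complement is analytic. **Proposition.** Ball selections exist. For every ball selection $(d_n)$, $\mathcal L$ is a Borel subset of $SB\times SB\times C(2^{\mathbb N})^{\mathbb N}$ and a standard Borel space (with the induced $\sigma$-algebra), and the following two subsets of $\mathcal L$ are coanalytic in $\mathcal L$: * $\mathcal W$, the set of those $(X,Y,(w_k))\in\mathcal L$ for which the operator $T\colon X\to Y$ with $Td_k(X)=w_k$ for all $k$ is weakly compact, that is, $T(B_X)$ is relatively compact in the weak topology of $Y$; * $\mathcal{SR}$, the set of those $(X,Y,(w_k))\in\mathcal L$ for which the adjoint $T^*\colon Y^*\to X^*$ of this operator has norm-separable range. -/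

import Mathlib

open Set TopologicalSpace

noncomputable section

/-- The Banach space `C(2^ℕ)` of real continuous functions on the Cantor space, with the
supremum norm. -/
abbrev CantorC : Type := C(ℕ → Bool, ℝ)

instance cantorCMeasurableSpace : MeasurableSpace CantorC := borel CantorC

instance cantorCBorelSpace : BorelSpace CantorC := ⟨rfl⟩

/-- The Effros-Borel σ-algebra on the closed subsets of a topological space, generated by the
sets `{F | F ∩ U ≠ ∅}` with `U` open. -/
abbrev effrosBorel (α : Type*) [TopologicalSpace α] : MeasurableSpace (Closeds α) :=
  MeasurableSpace.generateFrom
    {S | ∃ U : Set α, IsOpen U ∧ S = {F : Closeds α | ((F : Set α) ∩ U).Nonempty}}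

/-- The space `SB` of closed linear subspaces of `C(2^ℕ)`. -/
abbrev SB : Type := ClosedSubmodule ℝ CantorC

/-- `SB` carries the relative Effros-Borel σ-algebra. -/
instance sbMeasurableSpace : MeasurableSpace SB :=
  (effrosBorel CantorC).comap ClosedSubmodule.toCloseds

/-- The Banach space given by a point `X` of `SB`, with the norm of `C(2^ℕ)`. -/
def SBSpace (X : SB) : Type := X.toSubmodule

instance sbSpaceNormedAddCommGroup (X : SB) : NormedAddCommGroup (SBSpace X) :=
  inferInstanceAs (NormedAddCommGroup X.toSubmodule)

instance sbSpaceNormedSpace (X : SB) : NormedSpace ℝ (SBSpace X) :=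
  inferInstanceAs (NormedSpace ℝ X.toSubmodule)

instance sbSpaceCompleteSpace (X : SB) : CompleteSpace (SBSpace X) :=
  X.isClosed.completeSpace_coe

/-- The inclusion of `X` in `C(2^ℕ)`. -/
def sbIncl (X : SB) : SBSpace X →ₗᵢ[ℝ] CantorC := X.toSubmodule.subtypeₗᵢ

theorem range_sbIncl (X : SB) : range (sbIncl X) = (X : Set CantorC) :=
  Subtype.range_coe

/-- A subset of a measurable space is analytic if it is the image of a Polish space under a
Borel map. -/
def IsAnalyticSubset {α : Type*} [MeasurableSpace α] (A : Set α) : Prop :=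
  ∃ (P : Type) (_ : TopologicalSpace P) (_ : PolishSpace P) (_ : MeasurableSpace P)
    (_ : BorelSpace P) (f : P → α), Measurable f ∧ range f = A

/-- A subset of a measurable space is coanalytic if its complement is analytic. -/
def IsCoanalyticSubset {α : Type*} [MeasurableSpace α] (A : Set α) : Prop :=
  IsAnalyticSubset Aᶜ

/-- A sequence of Borel maps `d n : SB → C(2^ℕ)` choosing, for every closed subspace `X`, a
dense sequence in the closed unit ball of `X`, which consists of nonzero vectors if `X ≠ {0}`
and contains every nonzero rational combination of two of its terms that lies in the ball. -/
structure IsBallSelection (d : ℕ → SB → CantorC) : Prop where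
  measurable : ∀ n, Measurable (d n)
  mem : ∀ n (X : SB), d n X ∈ X
  norm_le : ∀ n (X : SB), ‖d n X‖ ≤ 1
  dense : ∀ (X : SB) (x : CantorC), x ∈ X → ‖x‖ ≤ 1 → x ∈ closure (range fun n => d n X)
  combination : ∀ (X : SB) (p q : ℚ) (m k : ℕ),
    ‖(q : ℝ) • d m X + (p : ℝ) • d k X‖ ≤ 1 → (q : ℝ) • d m X + (p : ℝ) • d k X ≠ 0 →
      ∃ l, d l X = (q : ℝ) • d m X + (p : ℝ) • d k X
  ne_zero : ∀ n (X : SB), (∃ x ∈ X, x ≠ 0) → d n X ≠ 0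

/-- The set `C_{X,Y}` of the sequences that code a bounded operator from `X` to `Y`. -/
def operatorCodes (d : ℕ → SB → CantorC) (X Y : SB) : Set (ℕ → CantorC) :=
  {w | (∀ k, w k ∈ Y) ∧
    (∀ (n m l : ℕ) (q p : ℚ), d n X = (q : ℝ) • d m X + (p : ℝ) • d l X →
      w n = (q : ℝ) • w m + (p : ℝ) • w l) ∧
    ∃ K : ℕ, ∀ a : ℕ →₀ ℚ,
      ‖a.sum fun i r => (r : ℝ) • w i‖ ≤ K * ‖a.sum fun i r => (r : ℝ) • d i X‖}

/-- The set `𝓛` of all codes `(X, Y, (w_k))` of operators. -/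
def codeSet (d : ℕ → SB → CantorC) : Set (SB × SB × (ℕ → CantorC)) :=
  {c | c.2.2 ∈ operatorCodes d c.1 c.2.1}

/-- The space `𝓛`, with the σ-algebra induced from the product `SB × SB × C(2^ℕ)^ℕ`. -/
abbrev CodeSpace (d : ℕ → SB → CantorC) : Type := ↥(codeSet d)

/-- The operator `T : X → Y` satisfies `T (d_k(X)) = w_k` for all `k`. -/
def Codes (d : ℕ → SB → CantorC) {X Y : SB} (w : ℕ → CantorC) (T : SBSpace X →L[ℝ] SBSpace Y) :
    Prop :=
  ∀ (k : ℕ) (x : SBSpace X), sbIncl X x = d k X → sbIncl Y (T x) = w k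

theorem existsUnique_operator {E F : Type*} [NormedAddCommGroup E] [NormedSpace ℝ E]
    [NormedAddCommGroup F] [NormedSpace ℝ F] [CompleteSpace F] (D : ℕ → E) (W : ℕ → F)
    (hD : ∀ x : E, ‖x‖ ≤ 1 → x ∈ closure (range D)) (K : ℝ)
    (hK : ∀ a : ℕ →₀ ℚ, ‖a.sum fun i r => (r : ℝ) • W i‖ ≤ K * ‖a.sum fun i r => (r : ℝ) • D i‖) :
    ∃! T : E →L[ℝ] F, ∀ k, T (D k) = W k := by
  let e : (ℕ →₀ ℝ) →ₗ[ℝ] E := Finsupp.linearCombination ℝ D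
  let f : (ℕ →₀ ℝ) →ₗ[ℝ] F := Finsupp.linearCombination ℝ W
  have hball : ∀ x : E, ‖x‖ ≤ 1 → x ∈ closure (range e) := by
    intro x hx
    refine closure_mono ?_ (hD x hx)
    rintro _ ⟨n, rfl⟩
    exact ⟨Finsupp.single n 1, by simp [e]⟩
  have he : DenseRange e := by
    intro x
    by_cases hx : x = 0
    · subst hx
      exact subset_closure ⟨0, by simp⟩
    · have hn : ‖x‖ ≠ 0 := by simpa using hx
      have h1 := hball (‖x‖⁻¹ • x) (by rw [norm_smul]; simp [hn])
      have h2 : (‖x‖ • (‖x‖⁻¹ • x)) ∈ (LinearMap.range e).topologicalClosure :=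
        Submodule.smul_mem _ _ (by
          rw [← SetLike.mem_coe, Submodule.topologicalClosure_coe]
          rw [LinearMap.coe_range]
          exact h1)
      rw [smul_smul, mul_inv_cancel₀ hn, one_smul, ← SetLike.mem_coe,
        Submodule.topologicalClosure_coe] at h2
      rw [LinearMap.coe_range] at h2
      exact h2
  have key : ∀ s : Finset ℕ, ∀ b : ℕ → ℝ,
      ‖∑ i ∈ s, b i • W i‖ ≤ K * ‖∑ i ∈ s, b i • D i‖ := by
    intro s b
    have hdr : DenseRange (fun (r : ℕ → ℚ) (i : ℕ) => (r i : ℝ)) :=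
      DenseRange.piMap fun _ => Rat.denseRange_cast
    refine hdr.induction_on (p := fun b : ℕ → ℝ =>
      ‖∑ i ∈ s, b i • W i‖ ≤ K * ‖∑ i ∈ s, b i • D i‖) b ?_ ?_
    · exact isClosed_le (by fun_prop) (by fun_prop)
    · intro r
      have h := hK (Finsupp.onFinset s (fun i => if i ∈ s then r i else 0) (by
        intro i hi
        by_contra hs
        simp [hs] at hi))
      rw [Finsupp.onFinset_sum _ (by simp), Finsupp.onFinset_sum _ (by simp)] at h
      rw [Finset.sum_congr rfl (g := fun i => ((r i : ℚ) : ℝ) • W i)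
        (fun i hi => by simp [hi]),
        Finset.sum_congr rfl (g := fun i => ((r i : ℚ) : ℝ) • D i)
        (fun i hi => by simp [hi])] at h
      exact h
  have hbound : ∀ a : ℕ →₀ ℝ, ‖f a‖ ≤ K * ‖e a‖ := fun a => key a.support a
  refine ⟨f.extendOfNorm e, ?_, ?_⟩
  · intro k
    have hxk : D k = e (Finsupp.single k 1) := by simp [e]
    rw [hxk, LinearMap.extendOfNorm_eq he ⟨K, hbound⟩]
    simp [f]
  · intro S hS
    refine (LinearMap.extendOfNorm_unique he K hbound S ?_).symm
    ext k
    simp [e, f, hS]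

theorem existsUnique_codes {d : ℕ → SB → CantorC} (hd : IsBallSelection d) (X Y : SB)
    (w : ℕ → CantorC) (hw : w ∈ operatorCodes d X Y) :
    ∃! T : SBSpace X →L[ℝ] SBSpace Y, Codes d w T := by
  obtain ⟨hwY, -, K, hK⟩ := hw
  have h1 : ∀ n, ∃ x : SBSpace X, sbIncl X x = d n X := fun n => by
    have h : d n X ∈ range (sbIncl X) := by rw [range_sbIncl]; exact hd.mem n X
    exact h
  have h2 : ∀ n, ∃ y : SBSpace Y, sbIncl Y y = w n := fun n => by
    have h : w n ∈ range (sbIncl Y) := by rw [range_sbIncl]; exact hwY n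
    exact h
  choose D hD using h1
  choose W hW using h2
  obtain ⟨T, hT, hu⟩ := existsUnique_operator D W (by
      intro x hx
      rw [(sbIncl X).isometry.isUniformInducing.isInducing.closure_eq_preimage_closure_image, ← range_comp]
      have hmem : sbIncl X x ∈ X := by
        rw [← SetLike.mem_coe, ← range_sbIncl]; exact mem_range_self x
      have h := hd.dense X (sbIncl X x) hmem (by rwa [LinearIsometry.norm_map])
      have he : (sbIncl X ∘ D) = fun n => d n X := funext hD
      rw [he]
      exact h) K (by
      intro a
      rw [← (sbIncl Y).norm_map, ← (sbIncl X).norm_map]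
      simpa [Finsupp.sum, hD, hW] using hK a)
  refine ⟨T, ?_, ?_⟩
  · intro k x hx
    have : x = D k := (sbIncl X).injective (by rw [hx, hD])
    rw [this, hT k, hW]
  · intro S hS
    exact hu S fun k => (sbIncl Y).injective (by rw [hW]; exact hS k _ (hD k))

/-- The operator coded by a point of `𝓛`: the unique bounded operator `T : X → Y` with
`T (d_k(X)) = w_k` for all `k`. -/
def codedOperator {d : ℕ → SB → CantorC} (hd : IsBallSelection d) (c : CodeSpace d) :
    SBSpace c.1.1 →L[ℝ] SBSpace c.1.2.1 :=
  (existsUnique_codes hd c.1.1 c.1.2.1 c.1.2.2 c.2).choose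

theorem codes_codedOperator {d : ℕ → SB → CantorC} (hd : IsBallSelection d) (c : CodeSpace d) :
    Codes d c.1.2.2 (codedOperator hd c) :=
  (existsUnique_codes hd c.1.1 c.1.2.1 c.1.2.2 c.2).choose_spec.1

/-- A bounded operator is weakly compact if the image of the closed unit ball is relatively
compact in the weak topology. -/
def IsWeaklyCompactOperator {E F : Type*} [NormedAddCommGroup E] [NormedSpace ℝ E]
    [NormedAddCommGroup F] [NormedSpace ℝ F] (T : E →L[ℝ] F) : Prop :=
  IsCompact (closure ((fun x => toWeakSpace ℝ F (T x)) '' Metric.closedBall (0 : E) 1))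

/-- The adjoint `T* : F* → E*`, `y* ↦ y* ∘ T`, has norm separable range. -/
def HasSeparableAdjointRange {E F : Type*} [NormedAddCommGroup E] [NormedSpace ℝ E]
    [NormedAddCommGroup F] [NormedSpace ℝ F] (T : E →L[ℝ] F) : Prop :=
  IsSeparable (range fun φ : StrongDual ℝ F => (φ.comp T : StrongDual ℝ E))

/-- The set `𝒲` of the codes of weakly compact operators. -/
def weaklyCompactCodes {d : ℕ → SB → CantorC} (hd : IsBallSelection d) : Set (CodeSpace d) :=
  {c | IsWeaklyCompactOperator (codedOperator hd c)}

/-- The set `𝒮ℛ` of the codes of operators whose adjoints have separable range. -/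
def separableAdjointCodes {d : ℕ → SB → CantorC} (hd : IsBallSelection d) :
    Set (CodeSpace d) :=
  {c | HasSeparableAdjointRange (codedOperator hd c)}

end

/-!
# Coanalyticity of weak compactness and of separability of the adjoint range

*Selections and Borel structure.* In `C(2^ℕ)`, the distance from a point to `X` is a Borel function
of `X`, so that points of a dense sequence can be chosen measurably with smaller and smaller
distance from `X`; their limits are Borel selections (`exists_measurable_dense_selections`). The
rational combinations of these in the punctured unit ball form a ball selection
(`exists_isBallSelection`). A ball selection is a Borel injection of `SB` into a countable power of
`C(2^ℕ)`, with the closed linear span as a Borel left inverse. Its range is therefore the Borel set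
on which span and selection compose to the identity, and `SB` is standard Borel. The set of codes
is defined by countable quantifiers over Borel conditions.

*Weak compactness.* By James' criterion, a bounded set is not relatively weakly compact iff it
contains a sequence for which, uniformly in `n`, the convex hull of the terms from `n` on stays away
from the span of the terms before `n`. This is `TailSeparated`, with
`exists_tailSeparated_of_not_isCompact` (a point of the weak* closure in the bidual outside of the
space, and Helly's theorem) and `TailSeparated.not_isCompact_closure` (Mazur's theorem). For the
image of the unit ball under the coded operator the sequence may be taken among the `w k`, which
makes the complement of `𝒲` a projection of a Borel set.

*Adjoint range.* The image of the dual unit ball of `Y` under the adjoint of the coded operator is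
identified with the sequences `(s k)` that satisfy `|∑ a k * s k| ≤ ‖∑ a k • w k‖` for all rational
`a` (`dualBallCodes`), a compact set in the product topology. It is not separable for the supremum
distance iff, for some `ε > 0`, it contains a sequence such that every neighbourhood of each term
contains another term at distance more than `ε` from it (`not_isSeparable_range_iff`). One direction
passes to the condensation points of an uncountable `ε`-separated set, the other one applies
Baire's theorem to the closure of the sequence. Thus the complement of `𝒮ℛ` is a projection of a
Borel set, too.
-/

/-! ### Relatively weakly compact sets and separated sequences -/

/-- A sequence `x` is `θ`-tail separated if every combination of its terms whose coefficients from
some index `n` on are nonnegative has norm at least `θ` times the sum of these coefficients. In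
particular the convex hull of `{x i | n ≤ i}` has distance at least `θ` from the span of
`{x i | i < n}`. The sign condition is encoded by absolute values, so that `r` runs through all
real sequences. -/
def TailSeparated {F : Type*} [NormedAddCommGroup F] [NormedSpace ℝ F] (θ : ℝ) (x : ℕ → F) :
    Prop :=
  ∀ (n : ℕ) (s : Finset ℕ) (r : ℕ → ℝ),
    θ * ∑ i ∈ s, (if n ≤ i then |r i| else 0) ≤ ‖∑ i ∈ s, (if n ≤ i then |r i| else r i) • x i‖

/-- Real and rational coefficients give the same notion. -/
theorem tailSeparated_iff_rat {F : Type*} [NormedAddCommGroup F] [NormedSpace ℝ F] (θ : ℝ)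
    (x : ℕ → F) :
    TailSeparated θ x ↔ ∀ (n : ℕ) (s : Finset ℕ) (r : ℕ →₀ ℚ),
      θ * ∑ i ∈ s, (if n ≤ i then |(r i : ℝ)| else 0) ≤
        ‖∑ i ∈ s, (if n ≤ i then |(r i : ℝ)| else (r i : ℝ)) • x i‖ := by
  refine ⟨fun h n s r => h n s fun i => (r i : ℝ), fun h n s r => ?_⟩
  have hdr : DenseRange (fun (r : ℕ → ℚ) (i : ℕ) => (r i : ℝ)) :=
    DenseRange.piMap fun _ => Rat.denseRange_cast
  refine hdr.induction_on (p := fun r : ℕ → ℝ =>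
    θ * ∑ i ∈ s, (if n ≤ i then |r i| else 0) ≤
      ‖∑ i ∈ s, (if n ≤ i then |r i| else r i) • x i‖) r ?_ fun q => ?_
  · refine isClosed_le (continuous_const.mul (continuous_finsetSum _ fun i _ => ?_))
      (continuous_norm.comp (continuous_finsetSum _ fun i _ => ?_))
    · split_ifs <;> fun_prop
    · split_ifs <;> fun_prop
  · have h' := h n s (Finsupp.onFinset s (fun i => if i ∈ s then q i else 0) (by
      intro i hi
      by_contra hs
      simp [hs] at hi))
    rw [Finset.sum_congr rfl (g := fun i => if n ≤ i then |(q i : ℝ)| else 0)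
        (fun i hi => by simp [hi]),
      Finset.sum_congr rfl (g := fun i => (if n ≤ i then |(q i : ℝ)| else (q i : ℝ)) • x i)
        (fun i hi => by simp [hi])] at h'
    exact h'

section James

variable {F : Type*} [NormedAddCommGroup F] [NormedSpace ℝ F]

theorem TailSeparated.le_norm_sub {θ : ℝ} {x : ℕ → F} (h : TailSeparated θ x) {n : ℕ}
    {a b : ℕ →₀ ℝ} (ha : ∀ i, n ≤ i → a i = 0) (hb : ∀ i < n, b i = 0) (hb0 : ∀ i, 0 ≤ b i)
    (hb1 : (b.sum fun _ t => t) = 1) :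
    θ ≤ ‖Finsupp.linearCombination ℝ x b - Finsupp.linearCombination ℝ x a‖ := by
  classical
  have h' := h n (a.support ∪ b.support) ⇑(b - a)
  rw [← map_sub, Finsupp.linearCombination_apply, Finsupp.sum_of_support_subset (b - a)
    (s := a.support ∪ b.support) (by rw [Finset.union_comm]; exact Finsupp.support_sub) _
    (by simp)]
  rw [Finsupp.sum_of_support_subset b (s := a.support ∪ b.support) Finset.subset_union_right _
    (by simp)] at hb1
  have h1 : ∀ i, (if n ≤ i then |(b - a) i| else 0) = b i := by
    intro i
    split_ifs with hi
    · simp [ha i hi, abs_of_nonneg (hb0 i)]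
    · exact (hb i (not_le.1 hi)).symm
  have h2 : ∀ i, (if n ≤ i then |(b - a) i| else (b - a) i) = (b - a) i := by
    intro i
    split_ifs with hi
    · simp [ha i hi, abs_of_nonneg (hb0 i)]
    · rfl
  simp only [h1, h2] at h'
  rwa [hb1, mul_one] at h'

theorem convexHull_image_Ici_subset (x : ℕ → F) (n : ℕ) :
    convexHull ℝ (x '' Ici n) ⊆ Finsupp.linearCombination ℝ x ''
      {b : ℕ →₀ ℝ | (∀ i < n, b i = 0) ∧ (∀ i, 0 ≤ b i) ∧ (b.sum fun _ t => t) = 1} := by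
  refine convexHull_min ?_ (Convex.linear_image ?_ _)
  · rintro _ ⟨i, hi, rfl⟩
    refine ⟨Finsupp.single i 1, ⟨fun j hj => ?_, fun j => ?_, by simp⟩, by simp⟩
    · exact Finsupp.single_eq_of_ne (ne_of_lt (lt_of_lt_of_le hj hi))
    · exact Finsupp.single_nonneg.2 zero_le_one j
  · intro b hb c hc s t hs ht hst
    refine ⟨fun i hi => by simp [hb.1 i hi, hc.1 i hi], fun i => ?_, ?_⟩
    · have := hb.2.1 i
      have := hc.2.1 i
      simp only [Finsupp.coe_add, Finsupp.coe_smul, Pi.add_apply, Pi.smul_apply, smul_eq_mul]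
      positivity
    · rw [Finsupp.sum_add_index' (by simp) (by simp), Finsupp.sum_smul_index (by simp),
        Finsupp.sum_smul_index (by simp)]
      have hb2 := hb.2.2
      have hc2 := hc.2.2
      simp only [Finsupp.sum] at hb2 hc2 ⊢
      rw [← Finset.mul_sum, ← Finset.mul_sum, hb2, hc2, mul_one, mul_one, hst]

/-- A weak cluster point of a tail separated sequence would lie in the norm closure of the convex
hull of every tail (Mazur), hence close to a convex combination of finitely many terms and close to
a convex combination of later terms. -/
theorem TailSeparated.not_isCompact_closure {θ : ℝ} (hθ : 0 < θ) {x : ℕ → F}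
    (h : TailSeparated θ x) {A : Set F} (hx : ∀ i, x i ∈ A) :
    ¬ IsCompact (closure (toWeakSpace ℝ F '' A)) := by
  intro hc
  obtain ⟨y, -, hy⟩ := hc.exists_mapClusterPt (f := Filter.atTop)
    (u := fun i => toWeakSpace ℝ F (x i))
    (Filter.tendsto_principal.2 (.of_forall fun i =>
      subset_closure (mem_image_of_mem _ (hx i))))
  obtain ⟨z, rfl⟩ := (toWeakSpace ℝ F).surjective y
  have key : ∀ n, z ∈ closure (convexHull ℝ (x '' Ici n)) := by
    intro n
    have h1 : toWeakSpace ℝ F z ∈ closure (toWeakSpace ℝ F '' convexHull ℝ (x '' Ici n)) := by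
      refine closure_mono ?_ (mapClusterPt_atTop_iff_forall_mem_closure.1 hy n)
      rw [← image_image]
      exact image_mono (subset_convexHull ℝ _)
    rw [← (convex_convexHull ℝ _).toWeakSpace_closure ℝ] at h1
    obtain ⟨z', hz', he⟩ := h1
    rwa [← (toWeakSpace ℝ F).injective he]
  obtain ⟨u, hu, hzu⟩ := Metric.mem_closure_iff.1 (key 0) (θ / 2) (by positivity)
  obtain ⟨a, -, rfl⟩ := convexHull_image_Ici_subset x 0 hu
  -- all coefficients of `a` vanish from the index `n` on
  let n := a.support.sup id + 1
  obtain ⟨v, hv, hzv⟩ := Metric.mem_closure_iff.1 (key n) (θ / 2) (by positivity)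
  obtain ⟨b, ⟨hb, hb0, hb1⟩, rfl⟩ := convexHull_image_Ici_subset x n hv
  -- both combinations lie within `θ / 2` of `z`, but have distance at least `θ`
  have h2 := h.le_norm_sub (n := n) (a := a) (b := b) (fun i hi => by
    by_contra hai
    have : i ≤ a.support.sup id := Finset.le_sup (f := id) (Finsupp.mem_support_iff.2 hai)
    omega) hb hb0 hb1
  rw [← dist_eq_norm] at h2
  have := dist_triangle_left (Finsupp.linearCombination ℝ x b) (Finsupp.linearCombination ℝ x a) z
  linarith

/-- A functional that is at most `θ` on the unit ball of a subspace agrees on the subspace with a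
functional of norm at most `θ`. -/
theorem exists_norm_le_eqOn (φ : StrongDual ℝ F) {θ : ℝ} (hθ : 0 ≤ θ) (M : Submodule ℝ F)
    (h : ∀ x ∈ M, ‖x‖ ≤ 1 → φ x ≤ θ) :
    ∃ ψ : StrongDual ℝ F, ‖ψ‖ ≤ θ ∧ ∀ x ∈ M, ψ x = φ x := by
  obtain ⟨ψ, hψ, hn⟩ := exists_extension_norm_eq M (φ.comp M.subtypeL)
  refine ⟨ψ, hn.le.trans ?_, fun x hx => hψ ⟨x, hx⟩⟩
  refine ContinuousLinearMap.opNorm_le_of_unit_norm hθ fun x hx => ?_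
  have hx' : ‖(x : F)‖ ≤ 1 := le_of_eq hx
  refine abs_le.2 ⟨?_, h x x.2 hx'⟩
  have := h (-x) (M.neg_mem x.2) (by rwa [norm_neg])
  rw [map_neg] at this
  change -θ ≤ φ x
  linarith

/-- Helly's theorem for a functional `φ` on the dual: if `φ` has distance more than `θ` from `F`,
then `θ < φ f` for some `f` in the dual unit ball that vanishes on a given finite set. Otherwise
the restriction of `φ` to the annihilator of the finite set has norm at most `θ`, and the
difference of `φ` and a norm preserving extension of this restriction is in the span of the set. -/
theorem exists_dual_vanishing_lt (φ : StrongDual ℝ (StrongDual ℝ F)) {θ : ℝ} (hθ : 0 ≤ θ)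
    (hφ : ∀ y : F, θ < ‖φ - NormedSpace.inclusionInDoubleDual ℝ F y‖) (S : Finset F) :
    ∃ f : StrongDual ℝ F, ‖f‖ ≤ 1 ∧ (∀ x ∈ S, f x = 0) ∧ θ < φ f := by
  by_contra! hcon
  let L : S → StrongDual ℝ F →ₗ[ℝ] ℝ := fun x =>
    (NormedSpace.inclusionInDoubleDual ℝ F x : StrongDual ℝ F →ₗ[ℝ] ℝ)
  let M : Submodule ℝ (StrongDual ℝ F) := ⨅ x, (L x).ker
  have hM : ∀ f ∈ M, ∀ x ∈ S, f x = 0 := by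
    intro f hf x hx
    have := (Submodule.mem_iInf _).1 hf ⟨x, hx⟩
    simpa [L] using this
  obtain ⟨ψ, hn, hψ⟩ := exists_norm_le_eqOn φ hθ M fun f hf hf1 => hcon f hf1 (hM f hf)
  have hspan : ((φ - ψ : StrongDual ℝ (StrongDual ℝ F)) : StrongDual ℝ F →ₗ[ℝ] ℝ) ∈
      Submodule.span ℝ (range L) := by
    refine mem_span_of_iInf_ker_le_ker fun f hf => ?_
    simp [hψ f hf]
  obtain ⟨y, hy⟩ : ∃ y : F, ((φ - ψ : StrongDual ℝ (StrongDual ℝ F)) : StrongDual ℝ F →ₗ[ℝ] ℝ) =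
      (NormedSpace.inclusionInDoubleDual ℝ F y : StrongDual ℝ F →ₗ[ℝ] ℝ) := by
    obtain ⟨c, hc⟩ := (Submodule.mem_span_range_iff_exists_fun ℝ).1 hspan
    refine ⟨∑ x, c x • (x : F), ?_⟩
    rw [← hc]
    ext f
    simp [L]
  have hy' : φ - NormedSpace.inclusionInDoubleDual ℝ F y = ψ := by
    rw [← ContinuousLinearMap.coe_injective hy]
    abel
  have := hφ y
  rw [hy'] at this
  exact absurd hn (not_le.2 this)

/-- James' criterion: a weak* closure point of `A` in the bidual outside of `F` provides functionals
`f n` in the dual unit ball and `x n ∈ A` with `f n (x k) = 0` for `k < n` and `θ < f n (x k)` for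
`n ≤ k`. -/
theorem exists_tailSeparated_of_not_isCompact [CompleteSpace F] {A : Set F}
    (hA : Bornology.IsBounded A) (hc : ¬ IsCompact (closure (toWeakSpace ℝ F '' A))) :
    ∃ θ > 0, ∃ x : ℕ → F, (∀ i, x i ∈ A) ∧ TailSeparated θ x := by
  classical
  have h1 : ¬ closure (NormedSpace.inclusionInDoubleDualWeak ℝ F '' (toWeakSpace ℝ F '' A)) ⊆
      range (NormedSpace.inclusionInDoubleDualWeak ℝ F) := fun h =>
    hc (NormedSpace.isCompact_closure_of_isBounded ℝ F _
      (by rwa [preimage_image_eq _ (toWeakSpace ℝ F).injective]) h)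
  obtain ⟨φ', hφ', hr⟩ := not_subset.1 h1
  let φ : StrongDual ℝ (StrongDual ℝ F) := WeakDual.toStrongDual φ'
  have hφA : φ ∉ range (NormedSpace.inclusionInDoubleDualLi (𝕜 := ℝ) (E := F)) := by
    rintro ⟨y, hy⟩
    exact hr ⟨toWeakSpace ℝ F y, DFunLike.ext _ _ fun f => DFunLike.congr_fun hy f⟩
  have hcl : IsClosed (range (NormedSpace.inclusionInDoubleDualLi (𝕜 := ℝ) (E := F))) :=
    (NormedSpace.inclusionInDoubleDualLi
      (𝕜 := ℝ) (E := F)).isometry.isUniformInducing.isComplete_range.isClosed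
  obtain ⟨ε, hε, hball⟩ := Metric.isOpen_iff.1 hcl.isOpen_compl φ hφA
  have hdist : ∀ y : F, ε / 2 < ‖φ - NormedSpace.inclusionInDoubleDual ℝ F y‖ := by
    intro y
    by_contra! hle
    refine hball (a := NormedSpace.inclusionInDoubleDualLi (𝕜 := ℝ) y) ?_ (mem_range_self y)
    exact Metric.mem_ball'.2
      ((dist_eq_norm φ _).trans_lt (lt_of_le_of_lt hle (half_lt_self hε)))
  -- by weak* density, `A` contains points at which finitely many functionals are as large as at `φ`
  have hap : ∀ S : Finset (StrongDual ℝ F), (∀ f ∈ S, ε / 2 < φ f) →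
      ∃ x ∈ A, ∀ f ∈ S, ε / 2 < f x := by
    intro S hS
    have hopen : IsOpen {ψ : WeakDual ℝ (StrongDual ℝ F) | ∀ f ∈ S, ε / 2 < ψ f} := by
      simp only [ofPred_forall]
      exact isOpen_biInter_finset fun f _ => isOpen_lt continuous_const (WeakDual.eval_continuous f)
    obtain ⟨_, hψ, _, ⟨x, hx, rfl⟩, rfl⟩ := mem_closure_iff.1 hφ' _ hopen hS
    exact ⟨x, hx, hψ⟩
  obtain ⟨p, hp, hpr⟩ := exists_seq_of_forall_finset_exists
    (fun p : F × StrongDual ℝ F => p.1 ∈ A ∧ ‖p.2‖ ≤ 1 ∧ ε / 2 < φ p.2 ∧ ε / 2 < p.2 p.1)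
    (fun p q => q.2 p.1 = 0 ∧ ε / 2 < p.2 q.1) (by
      intro S hS
      obtain ⟨f, hf1, hf0, hf⟩ :=
        exists_dual_vanishing_lt φ (by positivity) hdist (S.image Prod.fst)
      obtain ⟨x, hx, hfx⟩ := hap (insert f (S.image Prod.snd)) (by
        intro g hg
        rcases Finset.mem_insert.1 hg with rfl | hg
        · exact hf
        · obtain ⟨q, hq, rfl⟩ := Finset.mem_image.1 hg
          exact (hS q hq).2.2.1)
      exact ⟨(x, f), ⟨hx, hf1, hf, hfx f (Finset.mem_insert_self _ _)⟩, fun q hq =>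
        ⟨hf0 _ (Finset.mem_image_of_mem _ hq),
          hfx _ (Finset.mem_insert_of_mem (Finset.mem_image_of_mem _ hq))⟩⟩)
  refine ⟨ε / 2, by positivity, fun i => (p i).1, fun i => (hp i).1, fun n s r => ?_⟩
  let f := (p n).2
  calc ε / 2 * ∑ i ∈ s, (if n ≤ i then |r i| else 0)
      ≤ ∑ i ∈ s, (if n ≤ i then |r i| else r i) * f (p i).1 := by
        rw [Finset.mul_sum]
        refine Finset.sum_le_sum fun i _ => ?_
        split_ifs with hi
        · rw [mul_comm]
          refine mul_le_mul_of_nonneg_left ?_ (abs_nonneg _)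
          rcases hi.eq_or_lt with rfl | hi
          · exact (hp n).2.2.2.le
          · exact (hpr n i hi).2.le
        · rw [(hpr i n (not_le.1 hi)).1]
          simp
    _ = f (∑ i ∈ s, (if n ≤ i then |r i| else r i) • (p i).1) := by
        simp only [map_sum, map_smul, smul_eq_mul]
    _ ≤ ‖f (∑ i ∈ s, (if n ≤ i then |r i| else r i) • (p i).1)‖ := Real.le_norm_self _
    _ ≤ 1 * ‖∑ i ∈ s, (if n ≤ i then |r i| else r i) • (p i).1‖ := f.le_of_opNorm_le (hp n).2.1 _
    _ = _ := one_mul _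

/-- The image of the unit ball may be replaced by a norm dense subset of it. -/
theorem not_isWeaklyCompactOperator_iff {E : Type*} [NormedAddCommGroup E] [NormedSpace ℝ E]
    [CompleteSpace F] (T : E →L[ℝ] F) {D : ℕ → E} (hD1 : ∀ k, ‖D k‖ ≤ 1)
    (hD : ∀ x : E, ‖x‖ ≤ 1 → x ∈ closure (range D)) :
    ¬ IsWeaklyCompactOperator T ↔
      ∃ θ > 0, ∃ k : ℕ → ℕ, TailSeparated θ fun i => T (D (k i)) := by
  have hb : Bornology.IsBounded (range fun k => T (D k)) := by
    refine (Metric.isBounded_closedBall (x := (0 : F)) (r := ‖T‖)).subset ?_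
    rintro _ ⟨k, rfl⟩
    simpa using T.le_of_opNorm_le_of_le le_rfl (hD1 k)
  have hcl : closure ((fun x => toWeakSpace ℝ F (T x)) '' Metric.closedBall (0 : E) 1) =
      closure (toWeakSpace ℝ F '' range fun k => T (D k)) := by
    refine (closure_minimal ?_ isClosed_closure).antisymm (closure_mono ?_)
    · rintro _ ⟨x, hx, rfl⟩
      have h1 := hD x (by simpa using hx)
      have h2 : Continuous fun x => toWeakSpace ℝ F (T x) :=
        (toWeakSpaceCLM ℝ F).continuous.comp T.continuous
      have h3 := image_closure_subset_closure_image h2 (mem_image_of_mem _ h1)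
      rwa [← range_comp] at h3 ⊢
    · rintro _ ⟨_, ⟨k, rfl⟩, rfl⟩
      exact ⟨D k, by simpa using hD1 k, rfl⟩
  rw [IsWeaklyCompactOperator, hcl]
  constructor
  · intro h
    obtain ⟨θ, hθ, x, hx, hs⟩ := exists_tailSeparated_of_not_isCompact hb h
    choose k hk using hx
    exact ⟨θ, hθ, k, by simpa only [hk] using hs⟩
  · rintro ⟨θ, hθ, k, hs⟩
    exact hs.not_isCompact_closure hθ fun i => mem_range_self _

end James

/-! ### Nonseparable images of compact spaces -/

/-- In a nonseparable set some `ε`-separated subset is uncountable: a maximal `ε`-separated set is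
an `ε`-net. -/
theorem exists_uncountable_pairwise_dist {M : Type*} [PseudoMetricSpace M] {s : Set M}
    (hs : ¬ IsSeparable s) :
    ∃ ε : ℝ, 0 < ε ∧ ∃ t ⊆ s, ¬ t.Countable ∧ t.Pairwise fun x y => ε < dist x y := by
  by_contra! hcon
  refine hs ?_
  obtain ⟨t, -, ht, hst⟩ := EMetric.subset_countable_closure_of_almost_dense_set s (by
    intro δ hδ
    obtain ⟨ε, hε, hεδ⟩ := ENNReal.lt_iff_exists_nnreal_btwn.1 hδ
    replace hε : (0 : ℝ) < ε := by exact_mod_cast hε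
    obtain ⟨N, hN⟩ := zorn_subset {t | t ⊆ s ∧ t.Pairwise fun x y => (ε : ℝ) < dist x y} (by
      intro c hc hchain
      refine ⟨⋃₀ c, ⟨sUnion_subset fun t ht => (hc ht).1, ?_⟩, fun t ht => subset_sUnion_of_mem ht⟩
      exact (pairwise_sUnion hchain.directedOn).2 fun t ht => (hc ht).2)
    refine ⟨N, ?_, fun x hx => ?_⟩
    · by_contra hNc
      exact hcon ε hε N hN.prop.1 hNc hN.prop.2
    · by_contra hxN
      have hfar : ∀ y ∈ N, (ε : ℝ) < dist x y := by
        intro y hy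
        by_contra! hle
        refine hxN (mem_biUnion hy (Metric.mem_closedEBall.2 (le_trans ?_ hεδ.le)))
        rw [edist_nndist]
        exact_mod_cast hle
      have hmem : x ∈ N := hN.le_of_ge (y := insert x N)
        ⟨insert_subset hx hN.prop.1, hN.prop.2.insert fun y hy _ =>
          ⟨hfar y hy, by rw [dist_comm]; exact hfar y hy⟩⟩ (subset_insert x N) (mem_insert x N)
      have := hfar x hmem
      rw [dist_self] at this
      linarith)
  exact ⟨t, ht, hst⟩

/-- An uncountable subset of a second countable space contains a sequence without isolated points:
a dense sequence in the set of its condensation points. -/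
theorem exists_seq_of_not_countable {Z : Type*} [TopologicalSpace Z] [SecondCountableTopology Z]
    [T1Space Z] {S : Set Z} (hS : ¬ S.Countable) :
    ∃ u : ℕ → Z, (∀ n, u n ∈ S) ∧
      ∀ n, ∀ U : Set Z, IsOpen U → u n ∈ U → ∃ m, u m ∈ U ∧ u m ≠ u n := by
  let S' : Set Z := {z ∈ S | ∀ U : Set Z, IsOpen U → z ∈ U → ¬ (S ∩ U).Countable}
  -- a point that is not a condensation point lies in a basic open set with countable trace
  have hdiff : (S \ S').Countable := by
    have hsub : S \ S' ⊆ ⋃ U ∈ {U ∈ countableBasis Z | (S ∩ U).Countable}, S ∩ U := by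
      rintro z ⟨hz, hz'⟩
      have : ∃ U : Set Z, IsOpen U ∧ z ∈ U ∧ (S ∩ U).Countable := by
        by_contra! hcon
        exact hz' ⟨hz, hcon⟩
      obtain ⟨U, hU, hzU, hc⟩ := this
      obtain ⟨V, hV, hzV, hVU⟩ := (isBasis_countableBasis Z).exists_subset_of_mem_open hzU hU
      exact mem_iUnion₂.2 ⟨V, ⟨hV, hc.mono (inter_subset_inter_right _ hVU)⟩, hz, hzV⟩
    refine Countable.mono hsub (Countable.biUnion ((countable_countableBasis Z).mono
      (sep_subset _ _)) fun U hU => ?_)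
    rw [mem_sep_iff] at hU
    exact hU.2
  have hmeet : ∀ U : Set Z, IsOpen U → ∀ z ∈ S', z ∈ U → ∃ y ∈ S', y ∈ U ∧ y ≠ z := by
    intro U hU z hz hzU
    by_contra! hcon
    refine hz.2 U hU hzU ((hdiff.union (countable_singleton z)).mono fun y hy => ?_)
    by_cases hy' : y ∈ S'
    · exact Or.inr (hcon y hy' hy.2)
    · exact Or.inl ⟨hy.1, hy'⟩
  have hne : Nonempty S' := by
    by_contra hemp
    rw [not_nonempty_iff, isEmpty_coe_sort] at hemp
    rw [hemp, sdiff_empty] at hdiff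
    exact hS hdiff
  refine ⟨fun n => denseSeq S' n, fun n => (denseSeq S' n).2.1, fun n U hU hn => ?_⟩
  obtain ⟨y, hy, hyU, hyn⟩ := hmeet U hU _ (denseSeq S' n).2 hn
  obtain ⟨m, hm⟩ := (denseRange_denseSeq S').exists_mem_open
    ((hU.inter isOpen_compl_singleton).preimage continuous_subtype_val) ⟨⟨y, hy⟩, hyU, hyn⟩
  exact ⟨m, hm.1, hm.2⟩

/-- Let `G` be a map from a compact metrizable space to a metric space such that the preimages of
closed balls are closed. The range of `G` is nonseparable iff some nonempty countable set in the
domain has no nonempty relatively open subset whose image has small diameter. If the range is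
separable, this is impossible by Baire's theorem in the closure of the countable set. -/
theorem not_isSeparable_range_iff {Z M : Type*} [TopologicalSpace Z] [CompactSpace Z] [T2Space Z]
    [SecondCountableTopology Z] [PseudoMetricSpace M] (G : Z → M)
    (hG : ∀ c r, IsClosed {z | dist (G z) (G c) ≤ r}) :
    ¬ IsSeparable (range G) ↔ ∃ ε > 0, ∃ u : ℕ → Z, ∀ n, ∀ U : Set Z, IsOpen U → u n ∈ U →
      ∃ m, u m ∈ U ∧ ε < dist (G (u n)) (G (u m)) := by
  constructor
  · intro h
    obtain ⟨ε, hε, t, ht, htc, hsep⟩ := exists_uncountable_pairwise_dist h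
    have : Nonempty Z := by
      by_contra hZ
      rw [not_nonempty_iff] at hZ
      exact htc (((countable_range G)).mono ht)
    have hex : ∀ y ∈ t, ∃ z, G z = y := fun y hy => ht hy
    choose! g hg using hex
    -- distinct points of the sequence lie over distinct, hence `ε`-separated, points of `t`
    obtain ⟨u, hu, hacc⟩ := exists_seq_of_not_countable (S := g '' t) (by
      intro hc
      have hsub : t ⊆ G '' (g '' t) := fun y hy => ⟨g y, mem_image_of_mem g hy, hg y hy⟩
      exact htc ((hc.image G).mono hsub))
    refine ⟨ε, hε, u, fun n U hU hn => ?_⟩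
    obtain ⟨m, hm, hne⟩ := hacc n U hU hn
    refine ⟨m, hm, ?_⟩
    obtain ⟨x, hx, hxn⟩ := hu n
    obtain ⟨y, hy, hym⟩ := hu m
    rw [← hxn, ← hym, hg x hx, hg y hy]
    exact hsep hx hy fun hxy => hne (by rw [← hxn, ← hym, hxy])
  · rintro ⟨ε, hε, u, hu⟩ hsep
    obtain ⟨t, ht, htc, htd⟩ := hsep.exists_countable_dense_subset
    have := htc.to_subtype
    let P : Set Z := closure (range u)
    have hPc : CompactSpace P := isCompact_iff_compactSpace.1 isClosed_closure.isCompact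
    have hPn : Nonempty P := ⟨⟨u 0, subset_closure (mem_range_self 0)⟩⟩
    obtain ⟨⟨c, hc⟩, ⟨z, hz⟩⟩ := nonempty_interior_of_iUnion_of_closed
      (f := fun c : t => {z : P | dist (G z) c ≤ ε / 2}) (by
        rintro ⟨c, hc⟩
        obtain ⟨w, rfl⟩ := ht hc
        exact (hG w (ε / 2)).preimage continuous_subtype_val) (by
        refine eq_univ_of_forall fun z => mem_iUnion.2 ?_
        obtain ⟨c, hc, hd⟩ := Metric.mem_closure_iff.1 (htd (mem_range_self (z : Z))) (ε / 2)
          (by positivity)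
        exact ⟨⟨c, hc⟩, hd.le⟩)
    obtain ⟨O, hO, hOi⟩ := isOpen_induced_iff.1 (isOpen_interior
      (s := {z : P | dist (G z) c ≤ ε / 2}))
    have hball : ∀ n, u n ∈ O → dist (G (u n)) c ≤ ε / 2 := by
      intro n hn
      have : (⟨u n, subset_closure (mem_range_self n)⟩ : P) ∈ Subtype.val ⁻¹' O := hn
      rw [hOi] at this
      exact interior_subset (s := {z : P | dist (G z) c ≤ ε / 2}) this
    have hzO : (z : Z) ∈ O := by
      rw [← hOi] at hz
      exact hz
    obtain ⟨_, hnO, n, rfl⟩ := mem_closure_iff.1 z.2 O hO hzO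
    obtain ⟨m, hmO, hnm⟩ := hu n O hO hnO
    have h1 := hball n hnO
    have h2 := hball m hmO
    have := dist_triangle_right (G (u n)) (G (u m)) c
    linarith

/-! ### Separable ranges of adjoints -/

section Adjoint

/-- The sequences `(φ (w k))` for `φ` in the dual unit ball of a space containing the vectors
`w k`; by the theorem of Hahn and Banach these are the sequences dominated by the norm. -/
def dualBallCodes {F : Type*} [NormedAddCommGroup F] [NormedSpace ℝ F] (w : ℕ → F) :
    Set (ℕ → ℝ) :=
  {s | ∀ a : ℕ →₀ ℚ, |a.sum fun i r => (r : ℝ) * s i| ≤ ‖a.sum fun i r => (r : ℝ) • w i‖}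

variable {E F : Type*} [NormedAddCommGroup E] [NormedSpace ℝ E]
  [NormedAddCommGroup F] [NormedSpace ℝ F]

theorem mem_dualBallCodes_of_norm_le_one (w : ℕ → F) {φ : StrongDual ℝ F} (hφ : ‖φ‖ ≤ 1) :
    (fun k => φ (w k)) ∈ dualBallCodes w := by
  intro a
  have h : (a.sum fun i r => (r : ℝ) * φ (w i)) = φ (a.sum fun i r => (r : ℝ) • w i) := by
    simp [Finsupp.sum, map_sum]
  rw [h]
  simpa using φ.le_of_opNorm_le hφ (a.sum fun i r => (r : ℝ) • w i)

/-- The functional on the span of the `w k` that is given by a dominated sequence is well defined,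
has norm at most one, and extends by Hahn–Banach. -/
theorem exists_dual_of_mem_dualBallCodes {w : ℕ → F} {s : ℕ → ℝ} (hs : s ∈ dualBallCodes w) :
    ∃ φ : StrongDual ℝ F, ‖φ‖ ≤ 1 ∧ ∀ k, φ (w k) = s k := by
  let e : (ℕ →₀ ℝ) →ₗ[ℝ] F := Finsupp.linearCombination ℝ w
  let f : (ℕ →₀ ℝ) →ₗ[ℝ] ℝ := Finsupp.linearCombination ℝ s
  have key : ∀ t : Finset ℕ, ∀ b : ℕ → ℝ, |∑ i ∈ t, b i * s i| ≤ ‖∑ i ∈ t, b i • w i‖ := by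
    intro t b
    have hdr : DenseRange (fun (r : ℕ → ℚ) (i : ℕ) => (r i : ℝ)) :=
      DenseRange.piMap fun _ => Rat.denseRange_cast
    refine hdr.induction_on (p := fun b : ℕ → ℝ =>
      |∑ i ∈ t, b i * s i| ≤ ‖∑ i ∈ t, b i • w i‖) b ?_ fun r => ?_
    · exact isClosed_le (by fun_prop) (by fun_prop)
    · have h := hs (Finsupp.onFinset t (fun i => if i ∈ t then r i else 0) (by
        intro i hi
        by_contra hs
        simp [hs] at hi))
      rw [Finsupp.onFinset_sum _ (by simp), Finsupp.onFinset_sum _ (by simp)] at h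
      rw [Finset.sum_congr rfl (g := fun i => ((r i : ℚ) : ℝ) * s i)
        (fun i hi => by simp [hi]),
        Finset.sum_congr rfl (g := fun i => ((r i : ℚ) : ℝ) • w i)
        (fun i hi => by simp [hi])] at h
      exact h
  have hker : LinearMap.ker e.rangeRestrict ≤ LinearMap.ker f := by
    intro b hb
    rw [LinearMap.ker_rangeRestrict] at hb
    have h1 := key b.support b
    have h2 : ∑ i ∈ b.support, b i • w i = 0 := hb
    rw [h2, norm_zero] at h1
    exact abs_nonpos_iff.1 h1
  let h : LinearMap.range e →ₗ[ℝ] ℝ := ((LinearMap.ker e.rangeRestrict).liftQ f hker).comp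
    (e.rangeRestrict.quotKerEquivOfSurjective e.surjective_rangeRestrict).symm.toLinearMap
  have hh : ∀ b, h (e.rangeRestrict b) = f b := by
    intro b
    have : (e.rangeRestrict.quotKerEquivOfSurjective e.surjective_rangeRestrict).symm
        (e.rangeRestrict b) = Submodule.Quotient.mk b := by
      rw [LinearEquiv.symm_apply_eq]
      rfl
    simp only [h, LinearMap.comp_apply, LinearEquiv.coe_coe, this]
    rfl
  have hbd : ∀ y, ‖h y‖ ≤ 1 * ‖y‖ := by
    intro y
    obtain ⟨b, rfl⟩ := e.surjective_rangeRestrict y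
    rw [hh, one_mul]
    exact key b.support b
  obtain ⟨φ, hφ, hn⟩ := exists_extension_norm_eq (LinearMap.range e) (h.mkContinuous 1 hbd)
  refine ⟨φ, hn.le.trans (h.mkContinuous_norm_le zero_le_one hbd), fun k => ?_⟩
  have h1 := hφ (e.rangeRestrict (Finsupp.single k 1))
  have h2 := hh (Finsupp.single k 1)
  rw [LinearMap.mkContinuous_apply, h2] at h1
  simpa [e, f] using h1

theorem isCompact_dualBallCodes (w : ℕ → F) : IsCompact (dualBallCodes w) := by
  have hcl : IsClosed (dualBallCodes w) := by
    simp only [dualBallCodes, ofPred_forall]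
    refine isClosed_iInter fun a => isClosed_le ?_ continuous_const
    simp only [Finsupp.sum]
    fun_prop
  refine (isCompact_univ_pi fun k => isCompact_Icc (a := -‖w k‖) (b := ‖w k‖)).of_isClosed_subset
    hcl fun s hs k _ => abs_le.1 ?_
  simpa using hs (Finsupp.single k 1)

/-- Adjoints with nonseparable range, in terms of the vectors `T (D k)` only: the image of the dual
unit ball under the adjoint is, as a set of sequences `(φ (T (D k)))`, compact for the product
topology, and its norm distance is the supremum distance of sequences. -/
theorem not_hasSeparableAdjointRange_iff (T : E →L[ℝ] F) {D : ℕ → E} (hD1 : ∀ k, ‖D k‖ ≤ 1)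
    (hD : ∀ x : E, ‖x‖ ≤ 1 → x ∈ closure (range D)) :
    ¬ HasSeparableAdjointRange T ↔ ∃ ε > 0, ∃ u : ℕ → ℕ → ℝ,
      (∀ n, u n ∈ dualBallCodes fun k => T (D k)) ∧
      ∀ n, ∀ U ∈ countableBasis (ℕ → ℝ), u n ∈ U → ∃ m, u m ∈ U ∧ ∃ k, ε < |u n k - u m k| := by
  let Z := dualBallCodes fun k => T (D k)
  have hZ : CompactSpace Z := isCompact_iff_compactSpace.1 (isCompact_dualBallCodes _)
  have hex : ∀ s : Z, ∃ φ : StrongDual ℝ F, ‖φ‖ ≤ 1 ∧ ∀ k, φ (T (D k)) = (s : ℕ → ℝ) k :=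
    fun s => exists_dual_of_mem_dualBallCodes s.2
  choose φ hφ1 hφ using hex
  let G : Z → StrongDual ℝ E := fun s => (φ s).comp T
  have hGD : ∀ s k, G s (D k) = (s : ℕ → ℝ) k := hφ
  -- the norm of a functional is its supremum over the dense sequence
  have hnorm : ∀ (g : StrongDual ℝ E) {r : ℝ}, 0 ≤ r → (‖g‖ ≤ r ↔ ∀ k, |g (D k)| ≤ r) := by
    intro g r hr
    refine ⟨fun h k => ?_, fun h => ?_⟩
    · simpa using g.le_of_opNorm_le_of_le h (hD1 k)
    · refine ContinuousLinearMap.opNorm_le_of_unit_norm hr fun x hx => ?_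
      have hcl : IsClosed {x : E | ‖g x‖ ≤ r} := isClosed_le (by fun_prop) (by fun_prop)
      refine closure_minimal ?_ hcl (hD x hx.le)
      rintro _ ⟨k, rfl⟩
      exact h k
  have hdist : ∀ (s t : Z) {r : ℝ}, 0 ≤ r →
      (dist (G s) (G t) ≤ r ↔ ∀ k, |(s : ℕ → ℝ) k - (t : ℕ → ℝ) k| ≤ r) := by
    intro s t r hr
    rw [dist_eq_norm, hnorm _ hr]
    simp only [sub_apply, hGD]
  have hrange : range G = (fun ψ : StrongDual ℝ F => (ψ.comp T : StrongDual ℝ E)) ''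
      Metric.closedBall 0 1 := by
    refine Subset.antisymm ?_ ?_
    · rintro _ ⟨s, rfl⟩
      exact ⟨φ s, by simpa using hφ1 s, rfl⟩
    · rintro _ ⟨ψ, hψ, rfl⟩
      let s : Z := ⟨fun k => ψ (T (D k)),
        mem_dualBallCodes_of_norm_le_one (fun k => T (D k)) (by simpa using hψ)⟩
      refine ⟨s, ?_⟩
      have h0 : ‖G s - ψ.comp T‖ ≤ 0 := by
        refine (hnorm _ le_rfl).2 fun k => ?_
        rw [sub_apply, hGD]
        simp [s]
      exact sub_eq_zero.1 (norm_le_zero_iff.1 h0)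
  have hsep : HasSeparableAdjointRange T ↔ IsSeparable (range G) := by
    rw [hrange]
    refine ⟨fun h => h.mono (image_subset_range _ _), fun h => ?_⟩
    have h1 : IsSeparable (⋃ n : ℕ, (fun g : StrongDual ℝ E => (n : ℝ) • g) ''
        ((fun ψ : StrongDual ℝ F => (ψ.comp T : StrongDual ℝ E)) '' Metric.closedBall 0 1)) :=
      IsSeparable.iUnion fun n => h.image (continuous_const_smul _)
    refine h1.mono ?_
    rintro _ ⟨ψ, rfl⟩
    obtain ⟨n, hn⟩ := exists_nat_gt ‖ψ‖
    have hn0 : (0 : ℝ) < n := (norm_nonneg _).trans_lt hn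
    refine mem_iUnion.2 ⟨n, _, ⟨(n : ℝ)⁻¹ • ψ, ?_, rfl⟩, ?_⟩
    · rw [mem_closedBall_zero_iff, norm_smul, norm_inv, Real.norm_natCast, inv_mul_le_iff₀ hn0]
      linarith
    · ext x
      simp [hn0.ne']
  rw [hsep, not_isSeparable_range_iff G]
  · constructor
    · rintro ⟨ε, hε, u, hu⟩
      refine ⟨ε, hε, fun n => u n, fun n => (u n).2, fun n U hU hn => ?_⟩
      obtain ⟨m, hm, hd⟩ := hu n (Subtype.val ⁻¹' U)
        ((isOpen_of_mem_countableBasis hU).preimage continuous_subtype_val) hn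
      refine ⟨m, hm, ?_⟩
      rw [← not_le, hdist _ _ hε.le] at hd
      push Not at hd
      exact hd
    · rintro ⟨ε, hε, u, hu, h⟩
      refine ⟨ε, hε, fun n => ⟨u n, hu n⟩, fun n U hU hn => ?_⟩
      obtain ⟨V, hV, rfl⟩ := isOpen_induced_iff.1 hU
      obtain ⟨V', hV', hn', hVV'⟩ := (isBasis_countableBasis (ℕ → ℝ)).exists_subset_of_mem_open
        (show u n ∈ V from hn) hV
      obtain ⟨m, hm, k, hk⟩ := h n V' hV' hn'
      refine ⟨m, hVV' hm, ?_⟩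
      rw [← not_le, hdist _ _ hε.le]
      push Not
      exact ⟨k, hk⟩
  · intro c r
    rcases lt_or_ge r 0 with hr | hr
    · convert isClosed_empty
      ext z
      simpa using hr.trans_le dist_nonneg
    · simp only [hdist _ _ hr, ofPred_forall]
      exact isClosed_iInter fun k => isClosed_le ((((continuous_apply k).comp
        continuous_subtype_val).sub continuous_const).abs) continuous_const

end Adjoint

/-! ### Borel selections for the Effros–Borel structure -/

instance standardBorelSpace_cantorC : StandardBorelSpace CantorC := inferInstance

theorem measurableSet_inter_nonempty {U : Set CantorC} (hU : IsOpen U) :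
    MeasurableSet {X : SB | ((X : Set CantorC) ∩ U).Nonempty} :=
  ⟨_, MeasurableSpace.measurableSet_generateFrom ⟨U, hU, rfl⟩, rfl⟩

theorem measurable_infDist_SB (x : CantorC) :
    Measurable fun X : SB => Metric.infDist x (X : Set CantorC) := by
  refine measurable_of_Iio fun r => ?_
  convert measurableSet_inter_nonempty (Metric.isOpen_ball (x := x) (ε := r)) using 1
  ext X
  have hne : (X : Set CantorC).Nonempty := ⟨0, zero_mem X⟩
  simp only [mem_preimage, mem_Iio, Metric.infDist_lt_iff hne]
  exact exists_congr fun y => and_congr_right fun _ => by rw [Metric.mem_ball']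

/-- Successive measurable choice of natural numbers. -/
theorem exists_measurable_seq_nat {α : Type*} [MeasurableSpace α] (p : ℕ → α → ℕ → ℕ → Prop)
    (hp : ∀ k x j, ∃ j', p k x j j') (hm : ∀ k j j', MeasurableSet {x | p k x j j'}) :
    ∃ g : ℕ → α → ℕ, (∀ k, Measurable (g k)) ∧ (∀ x, g 0 x = 0) ∧
      ∀ k x, p k x (g k x) (g (k + 1) x) := by
  classical
  let g : ℕ → α → ℕ := fun k => Nat.rec (fun _ => 0) (fun k gk x => Nat.find (hp k x (gk x))) k
  refine ⟨g, fun k => ?_, fun _ => rfl, fun k x => Nat.find_spec (hp k x (g k x))⟩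
  induction k with
  | zero => exact measurable_const
  | succ k ih =>
    change Measurable fun x => Nat.find (hp k x (g k x))
    refine measurable_find (p := fun x N => p k x (g k x) N) (fun x => hp k x (g k x)) fun N => ?_
    have h : {x | p k x (g k x) N} = ⋃ j, g k ⁻¹' {j} ∩ {x | p k x j N} := by
      ext x
      simp
    rw [h]
    exact MeasurableSet.iUnion fun j => (ih (measurableSet_singleton j)).inter (hm k j N)

/-- A Borel selection whose value is almost as close to `x` as possible, obtained as the limit of
measurably chosen points of a dense sequence, the `k`-th of which has distance less than
`2⁻ᵏ (dist(x, X) + δ)` from `X`. -/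
theorem exists_measurable_selection_near (x : CantorC) {δ : ℝ} (hδ : 0 < δ) :
    ∃ f : SB → CantorC, Measurable f ∧ (∀ X, f X ∈ X) ∧
      ∀ X : SB, dist x (f X) ≤ 2 * (Metric.infDist x (X : Set CantorC) + δ) := by
  classical
  -- a dense sequence starting at `x`
  let z : ℕ → CantorC := fun n => Nat.casesOn n x (denseSeq CantorC)
  have hne : ∀ X : SB, (X : Set CantorC).Nonempty := fun X => ⟨0, zero_mem X⟩
  let ε : SB → ℝ := fun X => Metric.infDist x (X : Set CantorC) + δ
  have hε : ∀ X, 0 < ε X := fun X => add_pos_of_nonneg_of_pos Metric.infDist_nonneg hδ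
  have hεm : Measurable ε := (measurable_infDist_SB x).add_const δ
  let p : ℕ → SB → ℕ → ℕ → Prop := fun k X j j' =>
    Metric.infDist (z j) (X : Set CantorC) < ε X / 2 ^ k →
      Metric.infDist (z j') (X : Set CantorC) < ε X / 2 ^ (k + 1) ∧ dist (z j) (z j') < ε X / 2 ^ k
  have hp : ∀ k X j, ∃ j', p k X j j' := by
    intro k X j
    by_cases h : Metric.infDist (z j) (X : Set CantorC) < ε X / 2 ^ k
    · obtain ⟨y, hy, hjy⟩ := (Metric.infDist_lt_iff (hne X)).1 h
      obtain ⟨i, hi⟩ := Metric.denseRange_iff.1 (denseRange_denseSeq CantorC) y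
        (min (ε X / 2 ^ (k + 1)) (ε X / 2 ^ k - dist (z j) y))
        (lt_min (div_pos (hε X) (by positivity)) (by linarith))
      refine ⟨i + 1, fun _ => ⟨(Metric.infDist_lt_iff (hne X)).2 ⟨y, hy, ?_⟩, ?_⟩⟩
      · rw [dist_comm]
        exact hi.trans_le (min_le_left _ _)
      · have h1 := hi.trans_le (min_le_right _ _)
        have h2 := dist_triangle (z j) y (denseSeq CantorC i)
        change dist (z j) (denseSeq CantorC i) < _
        linarith
    · exact ⟨0, fun h' => absurd h' h⟩
  have hzm : ∀ h : SB → ℕ, Measurable h → Measurable fun X : SB => z (h X) := fun h hh =>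
    (measurable_of_countable z).comp hh
  obtain ⟨g, hgm, hg0, hgs⟩ := exists_measurable_seq_nat p hp (by
    intro k j j'
    refine measurableSet_setOfPred.2 (Measurable.imp ?_ (.and ?_ ?_))
    · exact measurableSet_setOfPred.1
        (measurableSet_lt (measurable_infDist_SB _) (hεm.div_const _))
    · exact measurableSet_setOfPred.1
        (measurableSet_lt (measurable_infDist_SB _) (hεm.div_const _))
    · exact measurableSet_setOfPred.1 (measurableSet_lt measurable_const (hεm.div_const _)))
  have hclose : ∀ X k, Metric.infDist (z (g k X)) (X : Set CantorC) < ε X / 2 ^ k := by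
    intro X k
    induction k with
    | zero =>
      rw [hg0, pow_zero, div_one]
      exact lt_add_of_pos_right _ hδ
    | succ k ih => exact (hgs k X ih).1
  have hstep : ∀ X k, dist (z (g k X)) (z (g (k + 1) X)) ≤ 2 * ε X / 2 / 2 ^ k := by
    intro X k
    rw [mul_div_cancel_left₀ _ (two_ne_zero)]
    exact (hgs k X (hclose X k)).2.le
  choose f hf using fun X => cauchySeq_tendsto_of_complete (cauchySeq_of_le_geometric_two (hstep X))
  refine ⟨f, measurable_of_tendsto_metrizable (fun k => hzm _ (hgm k))
    (tendsto_pi_nhds.2 hf), fun X => ?_, fun X => ?_⟩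
  · have hcl : IsClosed (X : Set CantorC) := X.isClosed
    refine (hcl.mem_iff_infDist_zero (hne X)).2 ?_
    refine tendsto_nhds_unique
      ((Metric.continuous_infDist_pt (X : Set CantorC)).continuousAt.tendsto.comp (hf X))
      (squeeze_zero (fun k => Metric.infDist_nonneg) (fun k => (hclose X k).le) ?_)
    have := (tendsto_pow_atTop_nhds_zero_of_lt_one (r := (1 / 2 : ℝ)) (by norm_num)
      (by norm_num)).const_mul (ε X)
    simpa [div_eq_mul_inv] using this
  · have h := dist_le_of_le_geometric_two_of_tendsto₀ (hstep X) (hf X)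
    rw [hg0] at h
    exact h

/-- The selection theorem of Kuratowski and Ryll-Nardzewski for closed subspaces. -/
theorem exists_measurable_dense_selections :
    ∃ s : ℕ → SB → CantorC, (∀ n, Measurable (s n)) ∧ (∀ n X, s n X ∈ X) ∧
      ∀ X : SB, (X : Set CantorC) ⊆ closure (range fun n => s n X) := by
  choose f hfm hfX hfd using fun i m : ℕ =>
    exists_measurable_selection_near (denseSeq CantorC i) (Nat.one_div_pos_of_nat (α := ℝ) (n := m))
  refine ⟨fun n => f n.unpair.1 n.unpair.2, fun n => hfm _ _, fun n => hfX _ _, fun X y hy => ?_⟩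
  refine Metric.mem_closure_iff.2 fun δ hδ => ?_
  obtain ⟨m, hm⟩ := exists_nat_one_div_lt (show 0 < δ / 5 by positivity)
  obtain ⟨i, hi⟩ := Metric.denseRange_iff.1 (denseRange_denseSeq CantorC) y (δ / 5) (by positivity)
  refine ⟨_, ⟨Nat.pair i m, rfl⟩, ?_⟩
  simp only [Nat.unpair_pair]
  have h1 := hfd i m X
  have h2 : Metric.infDist (denseSeq CantorC i) (X : Set CantorC) ≤ dist (denseSeq CantorC i) y :=
    Metric.infDist_le_dist_of_mem hy
  have h3 := dist_triangle y (denseSeq CantorC i) (f i m X)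
  rw [dist_comm _ y] at h2
  linarith

/-- Borel selections that are dense in every subspace and closed under rational combinations. -/
theorem exists_measurable_rational_selections :
    ∃ c : ℕ → SB → CantorC, (∀ n, Measurable (c n)) ∧ (∀ n X, c n X ∈ X) ∧
      (∀ X : SB, (X : Set CantorC) ⊆ closure (range fun n => c n X)) ∧
      ∀ (q p : ℚ) (m k : ℕ), ∃ l, ∀ X, c l X = (q : ℝ) • c m X + (p : ℝ) • c k X := by
  obtain ⟨s, hsm, hsX, hsd⟩ := exists_measurable_dense_selections
  obtain ⟨e, he⟩ := exists_surjective_nat (ℕ →₀ ℚ)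
  refine ⟨fun n X => (e n).sum fun i r => (r : ℝ) • s i X, fun n => ?_, fun n X => ?_, fun X => ?_,
    fun q p m k => ?_⟩
  · exact Finset.measurable_fun_sum _ fun i _ => (hsm i).const_smul ((e n i : ℚ) : ℝ)
  · exact X.toSubmodule.sum_mem fun i _ => X.toSubmodule.smul_mem _ (hsX i X)
  · refine (hsd X).trans (closure_mono ?_)
    rintro _ ⟨i, rfl⟩
    obtain ⟨n, hn⟩ := he (Finsupp.single i 1)
    exact ⟨n, by simp [hn]⟩
  · obtain ⟨l, hl⟩ := he (q • e m + p • e k)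
    refine ⟨l, fun X => ?_⟩
    simp only [hl]
    rw [Finsupp.sum_add_index' (by simp) (by intros; push_cast; rw [add_smul]),
      Finsupp.sum_smul_index (by simp), Finsupp.sum_smul_index (by simp)]
    simp [Finsupp.sum, Finset.smul_sum, mul_smul]

/-- Nonzero points are approximated by `t • y` with `t < 1`, the origin by multiples of any nonzero
vector. -/
theorem mem_closure_punctured_ball {X : SB} (hX : ∃ x ∈ X, x ≠ 0) {y : CantorC} (hy : y ∈ X)
    (hy1 : ‖y‖ ≤ 1) : y ∈ closure ({z : CantorC | z ≠ 0 ∧ ‖z‖ < 1} ∩ X) := by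
  rcases eq_or_ne y 0 with rfl | hy0
  · obtain ⟨x, hx, hx0⟩ := hX
    have hn : 0 < ‖x‖ := norm_pos_iff.2 hx0
    have h := map_mem_closure (f := fun t : ℝ => t • ‖x‖⁻¹ • x) (by fun_prop)
      (show (0 : ℝ) ∈ closure (Ioo 0 1) by rw [closure_Ioo zero_ne_one]; simp)
      (t := {z : CantorC | z ≠ 0 ∧ ‖z‖ < 1} ∩ X) (by
        rintro t ⟨ht0, ht1⟩
        refine ⟨⟨?_, ?_⟩, X.smul_mem _ (X.smul_mem _ hx)⟩
        · exact smul_ne_zero ht0.ne' (smul_ne_zero (by positivity) hx0)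
        · rw [norm_smul, norm_smul, norm_inv, norm_norm, inv_mul_cancel₀ hn.ne', mul_one,
            Real.norm_of_nonneg ht0.le]
          exact ht1)
    simpa using h
  · have h := map_mem_closure (f := fun t : ℝ => t • y) (by fun_prop)
      (show (1 : ℝ) ∈ closure (Ioo 0 1) by rw [closure_Ioo zero_ne_one]; simp)
      (t := {z : CantorC | z ≠ 0 ∧ ‖z‖ < 1} ∩ X) (by
        rintro t ⟨ht0, ht1⟩
        refine ⟨⟨smul_ne_zero ht0.ne' hy0, ?_⟩, X.smul_mem _ hy⟩
        rw [norm_smul, Real.norm_of_nonneg ht0.le]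
        nlinarith [norm_nonneg y])
    simpa using h

/-- Rational combinations of dense selections, where combinations outside of the punctured unit
ball are replaced by the first one inside, if there is any. -/
theorem exists_isBallSelection : ∃ d : ℕ → SB → CantorC, IsBallSelection d := by
  classical
  obtain ⟨c, hcm, hcX, hcd, hcc⟩ := exists_measurable_rational_selections
  let good : SB → ℕ → Prop := fun X n => c n X ≠ 0 ∧ ‖c n X‖ ≤ 1
  have hgood : ∀ n, MeasurableSet {X | good X n} := fun n =>
    (measurableSet_eq_fun (hcm n) measurable_const).compl.inter
      (measurableSet_le (hcm n).norm measurable_const)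
  have hN : ∀ X, ∃ N, good X N ∨ ∀ j, ¬ good X j := by
    intro X
    by_cases h : ∃ N, good X N
    · obtain ⟨N, h⟩ := h
      exact ⟨N, Or.inl h⟩
    · exact ⟨0, Or.inr (not_exists.1 h)⟩
  let N : SB → ℕ := fun X => Nat.find (hN X)
  have hNm : Measurable N := measurable_find _ fun k =>
    measurableSet_setOfPred.2 (.or (measurableSet_setOfPred.1 (hgood k))
      (.forall fun j => .not (measurableSet_setOfPred.1 (hgood j))))
  let d : ℕ → SB → CantorC := fun n X =>
    if good X n then c n X else if good X (N X) then c (N X) X else 0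
  have hd_good : ∀ {n X}, good X n → d n X = c n X := fun h => if_pos h
  have hd_or : ∀ n X, (∃ k, good X k ∧ d n X = c k X) ∨ d n X = 0 ∧ ∀ k, ¬ good X k := by
    intro n X
    by_cases h : good X n
    · exact Or.inl ⟨n, h, if_pos h⟩
    · by_cases h' : good X (N X)
      · exact Or.inl ⟨N X, h', by simp only [d, if_neg h, if_pos h']⟩
      · exact Or.inr ⟨by simp only [d, if_neg h, if_neg h'],
          (Nat.find_spec (hN X)).resolve_left h'⟩
  have hdense : ∀ X : SB, (∃ x ∈ X, x ≠ 0) → ∀ y ∈ X, ‖y‖ ≤ 1 →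
      y ∈ closure ({z : CantorC | z ≠ 0 ∧ ‖z‖ < 1} ∩ range fun n => c n X) := by
    intro X hX y hy hy1
    have hO : IsOpen {z : CantorC | z ≠ 0 ∧ ‖z‖ < 1} :=
      isOpen_ne.inter (isOpen_lt continuous_norm continuous_const)
    have h1 := mem_closure_punctured_ball hX hy hy1
    refine closure_minimal ?_ isClosed_closure h1
    exact (inter_subset_inter_right _ (hcd X)).trans hO.inter_closure
  have hex : ∀ X : SB, (∃ x ∈ X, x ≠ 0) → ∃ k, good X k := by
    intro X hX
    obtain ⟨_, ⟨h0, h1⟩, k, rfl⟩ :=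
      closure_nonempty_iff.1 ⟨0, hdense X hX 0 (zero_mem X) (by simp)⟩
    exact ⟨k, h0, h1.le⟩
  refine ⟨d, ⟨fun n => ?_, fun n X => ?_, fun n X => ?_, fun X x hx hx1 => ?_,
    fun X p q m k h1 h0 => ?_, fun n X hX => ?_⟩⟩
  · have hu : Measurable fun q : SB × ℕ => c q.2 q.1 :=
      measurable_from_prod_countable_left fun j => hcm j
    have hcN : Measurable fun X => c (N X) X := hu.comp (measurable_id.prodMk hNm)
    refine Measurable.ite (hgood n) (hcm n) (Measurable.ite ?_ hcN measurable_const)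
    exact (measurableSet_eq_fun hcN measurable_const).compl.inter
      (measurableSet_le hcN.norm measurable_const)
  · rcases hd_or n X with ⟨k, -, h⟩ | ⟨h, -⟩ <;> rw [h]
    exacts [hcX k X, zero_mem X]
  · rcases hd_or n X with ⟨k, hk, h⟩ | ⟨h, -⟩ <;> rw [h]
    exacts [hk.2, by simp]
  · by_cases hX : ∃ x ∈ X, x ≠ 0
    · refine closure_mono ?_ (hdense X hX x hx hx1)
      rintro _ ⟨⟨h0, h1⟩, n, rfl⟩
      exact ⟨n, hd_good ⟨h0, h1.le⟩⟩
    · push Not at hX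
      refine subset_closure ⟨0, ?_⟩
      rw [hX x hx]
      rcases hd_or 0 X with ⟨k, hk, -⟩ | ⟨h, -⟩
      exacts [absurd (hX _ (hcX k X)) hk.1, h]
  · have hrep : ∀ n, ∃ k, d n X = c k X := by
      intro n
      rcases hd_or n X with ⟨k, -, h⟩ | ⟨h, -⟩
      · exact ⟨k, h⟩
      · obtain ⟨l, hl⟩ := hcc 0 0 0 0
        exact ⟨l, by rw [h, hl]; simp⟩
    obtain ⟨m', hm⟩ := hrep m
    obtain ⟨k', hk⟩ := hrep k
    obtain ⟨l, hl⟩ := hcc q p m' k'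
    rw [hm, hk, ← hl] at h1 h0 ⊢
    exact ⟨l, hd_good ⟨h0, h1⟩⟩
  · rcases hd_or n X with ⟨k, hk, h⟩ | ⟨-, h⟩
    · rw [h]
      exact hk.1
    · obtain ⟨k, hk⟩ := hex X hX
      exact absurd hk (h k)

/-! ### Standard Borel structures -/

/-- The closed linear span of a sequence. -/
def closedSpanSeq (x : ℕ → CantorC) : SB := (Submodule.span ℝ (range x)).closure

theorem measurable_closedSpanSeq : Measurable closedSpanSeq := by
  refine measurable_comap_iff.2 (measurable_generateFrom ?_)
  rintro _ ⟨U, hU, rfl⟩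
  have h : (ClosedSubmodule.toCloseds ∘ closedSpanSeq) ⁻¹'
      {F : Closeds CantorC | ((F : Set CantorC) ∩ U).Nonempty} =
      ⋃ a : ℕ →₀ ℚ, {x : ℕ → CantorC | (a.sum fun i r => (r : ℝ) • x i) ∈ U} := by
    ext x
    have h1 : x ∈ (ClosedSubmodule.toCloseds ∘ closedSpanSeq) ⁻¹'
        {F : Closeds CantorC | ((F : Set CantorC) ∩ U).Nonempty} ↔
        (closure (Submodule.span ℝ (range x) : Set CantorC) ∩ U).Nonempty := Iff.rfl
    rw [h1, closure_inter_open_nonempty_iff hU, mem_iUnion]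
    constructor
    · rintro ⟨y, hy, hyU⟩
      obtain ⟨b, rfl⟩ := Finsupp.mem_span_range_iff_exists_finsupp.1 hy
      have hdr : DenseRange (fun (r : ℕ → ℚ) (i : ℕ) => (r i : ℝ)) :=
        DenseRange.piMap fun _ => Rat.denseRange_cast
      obtain ⟨r, hr⟩ := hdr.exists_mem_open
        (hU.preimage (f := fun b' : ℕ → ℝ => ∑ i ∈ b.support, b' i • x i) (by fun_prop)) ⟨b, hyU⟩
      refine ⟨Finsupp.onFinset b.support (fun i => if i ∈ b.support then r i else 0) (by
        intro i hi
        by_contra hs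
        simp [hs] at hi), ?_⟩
      rw [mem_ofPred_eq, Finsupp.onFinset_sum _ (by simp)]
      rw [Finset.sum_congr rfl (g := fun i => ((r i : ℚ) : ℝ) • x i)
        (fun i hi => by simp only [if_pos hi])]
      exact hr
    · rintro ⟨a, ha⟩
      exact ⟨_, Submodule.sum_mem _ fun i _ =>
        Submodule.smul_mem _ _ (Submodule.subset_span (mem_range_self i)), ha⟩
  rw [h]
  refine MeasurableSet.iUnion fun a => (hU.preimage ?_).measurableSet
  simp only [Finsupp.sum]
  fun_prop

theorem IsBallSelection.closedSpanSeq_eq {d : ℕ → SB → CantorC} (hd : IsBallSelection d) (X : SB) :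
    closedSpanSeq (fun n => d n X) = X := by
  refine SetLike.coe_injective (Subset.antisymm ?_ fun x hx => ?_)
  · refine closure_minimal ?_ X.isClosed
    refine (Submodule.span_le (p := X.toSubmodule)).2 ?_
    rintro _ ⟨n, rfl⟩
    exact hd.mem n X
  · rcases eq_or_ne x 0 with rfl | hx0
    · exact zero_mem (closedSpanSeq fun n => d n X)
    · have hn : ‖x‖ ≠ 0 := norm_ne_zero_iff.2 hx0
      have h1 := hd.dense X (‖x‖⁻¹ • x) (X.smul_mem _ hx)
        (by rw [norm_smul, norm_inv, norm_norm, inv_mul_cancel₀ hn])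
      have h2 : ‖x‖⁻¹ • x ∈ closedSpanSeq (fun n => d n X) :=
        closure_mono Submodule.subset_span h1
      have h3 := (closedSpanSeq fun n => d n X).smul_mem ‖x‖ h2
      rwa [smul_smul, mul_inv_cancel₀ hn, one_smul] at h3

theorem StandardBorelSpace.of_measurableEquiv {α β : Type*} [MeasurableSpace α] [MeasurableSpace β]
    [StandardBorelSpace β] (e : α ≃ᵐ β) : StandardBorelSpace α := by
  obtain ⟨τ, hB, hP⟩ := StandardBorelSpace.polish (α := β)
  refine ⟨⟨τ.induced e, @BorelSpace.mk _ (τ.induced e) _ ?_, e.toEquiv.polishSpace_induced⟩⟩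
  rw [borel_comap]
  exact e.measurableEmbedding.comap_eq.symm.trans
    (congrArg (fun m => MeasurableSpace.comap e.toEquiv m) hB.measurable_eq)

/-- A ball selection is a Borel injection into a Polish space with Borel left inverse
`closedSpanSeq`, so that its range is Borel. -/
instance standardBorelSpace_SB : StandardBorelSpace SB := by
  obtain ⟨d, hd⟩ := exists_isBallSelection
  have hdm : Measurable fun X n => d n X := measurable_pi_lambda _ hd.measurable
  let R : Set (ℕ → CantorC) := {x | (fun n => d n (closedSpanSeq x)) = x}
  have hR : MeasurableSet R :=
    measurableSet_eq_fun (hdm.comp measurable_closedSpanSeq) measurable_id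
  have := hR.standardBorel
  have hmem : ∀ X : SB, (fun n => d n X) ∈ R := by
    intro X
    change (fun n => d n (closedSpanSeq fun n => d n X)) = _
    rw [hd.closedSpanSeq_eq]
  let e : SB ≃ᵐ R :=
    { toFun := fun X => ⟨fun n => d n X, hmem X⟩
      invFun := fun x => closedSpanSeq x
      left_inv := hd.closedSpanSeq_eq
      right_inv := fun x => Subtype.ext x.2
      measurable_toFun := hdm.subtype_mk (h := hmem)
      measurable_invFun := measurable_closedSpanSeq.comp measurable_subtype_coe }
  exact StandardBorelSpace.of_measurableEquiv e

/-! ### The space of codes -/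

/-- Membership in a subspace, by countably many conditions on a ball selection. -/
theorem IsBallSelection.mem_iff {d : ℕ → SB → CantorC} (hd : IsBallSelection d) (Y : SB)
    (w : CantorC) : w ∈ Y ↔ ∀ m : ℕ, ∃ (j : ℕ) (q : ℚ), dist w ((q : ℝ) • d j Y) < 1 / (m + 1) := by
  constructor
  · intro hw m
    obtain ⟨n, hn⟩ := exists_nat_gt ‖w‖
    have hn0 : (0 : ℝ) < n := (norm_nonneg w).trans_lt hn
    have h1 := hd.dense Y ((n : ℝ)⁻¹ • w) (Y.smul_mem _ hw) (by
      rw [norm_smul, norm_inv, Real.norm_natCast, inv_mul_le_iff₀ hn0]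
      linarith)
    obtain ⟨_, ⟨j, rfl⟩, hj⟩ := Metric.mem_closure_iff.1 h1 ((n : ℝ)⁻¹ * (1 / (m + 1)))
      (by positivity)
    refine ⟨j, n, ?_⟩
    have h2 : dist w (((n : ℚ) : ℝ) • d j Y) = n * dist ((n : ℝ)⁻¹ • w) (d j Y) := by
      have h3 : w = (n : ℝ) • (n : ℝ)⁻¹ • w := by rw [smul_smul, mul_inv_cancel₀ hn0.ne', one_smul]
      conv_lhs => rw [h3]
      rw [Rat.cast_natCast, dist_eq_norm, dist_eq_norm, ← smul_sub, norm_smul, Real.norm_natCast]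
    rw [h2]
    calc n * dist ((n : ℝ)⁻¹ • w) (d j Y) < n * ((n : ℝ)⁻¹ * (1 / (m + 1))) :=
          mul_lt_mul_of_pos_left hj hn0
      _ = 1 / (m + 1) := mul_inv_cancel_left₀ hn0.ne' _
  · intro h
    have hcl : IsClosed (Y : Set CantorC) := Y.isClosed
    refine hcl.closure_subset (Metric.mem_closure_iff.2 fun ε hε => ?_)
    obtain ⟨m, hm⟩ := exists_nat_one_div_lt hε
    obtain ⟨j, q, hj⟩ := h m
    exact ⟨_, Y.smul_mem _ (hd.mem j Y), hj.trans hm⟩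

theorem IsBallSelection.measurableSet_codeSet {d : ℕ → SB → CantorC} (hd : IsBallSelection d) :
    MeasurableSet (codeSet d) := by
  have hX : ∀ n, Measurable fun c : SB × SB × (ℕ → CantorC) => d n c.1 := fun n =>
    (hd.measurable n).comp measurable_fst
  have hY : ∀ n, Measurable fun c : SB × SB × (ℕ → CantorC) => d n c.2.1 := fun n =>
    (hd.measurable n).comp (measurable_fst.comp measurable_snd)
  have hw : ∀ n, Measurable fun c : SB × SB × (ℕ → CantorC) => c.2.2 n := fun n =>
    (measurable_pi_apply n).comp (measurable_snd.comp measurable_snd)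
  refine measurableSet_setOfPred.2 (.and (.forall fun k => ?_)
    (.and (.forall fun n => .forall fun m => .forall fun l => .forall fun q => .forall fun p =>
      .imp ?_ ?_) (.exists fun K => .forall fun a => ?_)))
  · simp only [hd.mem_iff]
    exact .forall fun m => .exists fun j => .exists fun q => measurableSet_setOfPred.1
      (measurableSet_lt ((hw k).dist ((hY j).const_smul (q : ℝ))) measurable_const)
  · exact measurableSet_setOfPred.1
      (measurableSet_eq_fun (hX n) (((hX m).const_smul (q : ℝ)).add ((hX l).const_smul (p : ℝ))))
  · exact measurableSet_setOfPred.1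
      (measurableSet_eq_fun (hw n) (((hw m).const_smul (q : ℝ)).add ((hw l).const_smul (p : ℝ))))
  · refine measurableSet_setOfPred.1 (measurableSet_le (Measurable.norm ?_)
      (Measurable.const_mul (Measurable.norm ?_) _))
    · exact Finset.measurable_fun_sum _ fun i _ => (hw i).const_smul ((a i : ℚ) : ℝ)
    · exact Finset.measurable_fun_sum _ fun i _ => (hX i).const_smul ((a i : ℚ) : ℝ)

/-- Projections of Borel sets in products of standard Borel spaces are analytic. -/
theorem isAnalyticSubset_exists {α P : Type} [MeasurableSpace α] [StandardBorelSpace α]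
    [MeasurableSpace P] [StandardBorelSpace P] {B : Set (α × P)} (hB : MeasurableSet B) :
    IsAnalyticSubset {a | ∃ p, (a, p) ∈ B} := by
  have := hB.standardBorel
  obtain ⟨τ, hb, hp⟩ := StandardBorelSpace.polish (α := B)
  refine ⟨B, τ, hp, inferInstance, hb, fun b => b.1.1,
    measurable_fst.comp measurable_subtype_coe, ?_⟩
  ext a
  constructor
  · rintro ⟨⟨⟨a', p⟩, h⟩, rfl⟩
    exact ⟨p, h⟩
  · rintro ⟨p, h⟩
    exact ⟨⟨(a, p), h⟩, rfl⟩

theorem tailSeparated_comp_linearIsometry {F G : Type*} [NormedAddCommGroup F] [NormedSpace ℝ F]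
    [NormedAddCommGroup G] [NormedSpace ℝ G] (J : F →ₗᵢ[ℝ] G) (θ : ℝ) (x : ℕ → F) :
    TailSeparated θ (fun i => J (x i)) ↔ TailSeparated θ x := by
  simp only [TailSeparated, ← map_smul, ← map_sum, J.norm_map]

theorem dualBallCodes_comp_linearIsometry {F G : Type*} [NormedAddCommGroup F] [NormedSpace ℝ F]
    [NormedAddCommGroup G] [NormedSpace ℝ G] (J : F →ₗᵢ[ℝ] G) (w : ℕ → F) :
    dualBallCodes (fun i => J (w i)) = dualBallCodes w := by
  simp only [dualBallCodes, Finsupp.sum, ← map_smul, ← map_sum, J.norm_map]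

section Codes

variable {d : ℕ → SB → CantorC}

/-- A ball selection, viewed as a sequence in the space `X`. -/
theorem IsBallSelection.exists_seq (hd : IsBallSelection d) (c : CodeSpace d) :
    ∃ D : ℕ → SBSpace c.1.1, (∀ k, ‖D k‖ ≤ 1) ∧
      (∀ x : SBSpace c.1.1, ‖x‖ ≤ 1 → x ∈ closure (range D)) ∧
      ∀ k, sbIncl c.1.2.1 (codedOperator hd c (D k)) = c.1.2.2 k := by
  have h1 : ∀ n, ∃ x : SBSpace c.1.1, sbIncl c.1.1 x = d n c.1.1 := fun n => by
    have h : d n c.1.1 ∈ range (sbIncl c.1.1) := by rw [range_sbIncl]; exact hd.mem n _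
    exact h
  choose D hD using h1
  refine ⟨D, fun k => ?_, fun x hx => ?_, fun k => codes_codedOperator hd c k _ (hD k)⟩
  · rw [← (sbIncl c.1.1).norm_map, hD]
    exact hd.norm_le k _
  · rw [(sbIncl c.1.1).isometry.isUniformInducing.isInducing.closure_eq_preimage_closure_image,
      ← range_comp]
    have hmem : sbIncl c.1.1 x ∈ c.1.1 := by
      rw [← SetLike.mem_coe, ← range_sbIncl]
      exact mem_range_self x
    have he : (sbIncl c.1.1 ∘ D) = fun n => d n c.1.1 := funext hD
    rw [he]
    exact hd.dense _ _ hmem (by rwa [LinearIsometry.norm_map])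

/-- The terms `w k` of a code are the images of a dense sequence of the unit ball, so the witnesses
of weak noncompactness can be taken among them. -/
theorem mem_compl_weaklyCompactCodes (hd : IsBallSelection d) (c : CodeSpace d) :
    c ∈ (weaklyCompactCodes hd)ᶜ ↔
      ∃ p : ℝ × (ℕ → ℕ), 0 < p.1 ∧ TailSeparated p.1 fun i => c.1.2.2 (p.2 i) := by
  obtain ⟨D, hD1, hD, hT⟩ := hd.exists_seq c
  have h : c ∈ (weaklyCompactCodes hd)ᶜ ↔ ¬ IsWeaklyCompactOperator (codedOperator hd c) := Iff.rfl
  rw [h, not_isWeaklyCompactOperator_iff _ hD1 hD, Prod.exists]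
  simp only [← hT, tailSeparated_comp_linearIsometry]
  exact exists_congr fun θ => ⟨fun ⟨h0, k, hk⟩ => ⟨k, h0, hk⟩, fun ⟨k, h0, hk⟩ => ⟨h0, k, hk⟩⟩

/-- The countable basis is indexed by a subtype in order that all quantifiers inside of the outer
existential one run through countable types. -/
theorem mem_compl_separableAdjointCodes (hd : IsBallSelection d) (c : CodeSpace d) :
    c ∈ (separableAdjointCodes hd)ᶜ ↔
      ∃ p : ℝ × (ℕ → ℕ → ℝ), 0 < p.1 ∧ (∀ n, p.2 n ∈ dualBallCodes c.1.2.2) ∧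
        ∀ n, ∀ U : countableBasis (ℕ → ℝ), p.2 n ∈ (U : Set (ℕ → ℝ)) →
          ∃ m, p.2 m ∈ (U : Set (ℕ → ℝ)) ∧ ∃ k, p.1 < |p.2 n k - p.2 m k| := by
  obtain ⟨D, hD1, hD, hT⟩ := hd.exists_seq c
  have h : c ∈ (separableAdjointCodes hd)ᶜ ↔ ¬ HasSeparableAdjointRange (codedOperator hd c) :=
    Iff.rfl
  have hw : c.1.2.2 = fun k => sbIncl c.1.2.1 (codedOperator hd c (D k)) :=
    funext fun k => (hT k).symm
  rw [h, not_hasSeparableAdjointRange_iff _ hD1 hD, Prod.exists, hw,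
    dualBallCodes_comp_linearIsometry]
  simp only [Subtype.forall]
  exact exists_congr fun ε => ⟨fun ⟨h0, u, hu⟩ => ⟨u, h0, hu⟩, fun ⟨u, h0, hu⟩ => ⟨h0, u, hu⟩⟩

theorem measurable_code_apply (n : ℕ) : Measurable fun c : CodeSpace d => c.1.2.2 n :=
  (measurable_pi_apply n).comp (measurable_snd.comp (measurable_snd.comp measurable_subtype_coe))

theorem measurableSet_tailSeparated :
    MeasurableSet {q : CodeSpace d × (ℝ × (ℕ → ℕ)) |
      0 < q.2.1 ∧ TailSeparated q.2.1 fun i => q.1.1.2.2 (q.2.2 i)} := by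
  have hθ : Measurable fun q : CodeSpace d × (ℝ × (ℕ → ℕ)) => q.2.1 :=
    measurable_fst.comp measurable_snd
  have hw : ∀ i, Measurable fun q : CodeSpace d × (ℝ × (ℕ → ℕ)) => q.1.1.2.2 (q.2.2 i) := by
    intro i
    have h1 : Measurable fun q : CodeSpace d × ℕ => q.1.1.2.2 q.2 :=
      measurable_from_prod_countable_left fun j => measurable_code_apply j
    exact h1.comp (measurable_fst.prodMk
      ((measurable_pi_apply i).comp (measurable_snd.comp measurable_snd)))
  simp only [tailSeparated_iff_rat]
  refine measurableSet_setOfPred.2 (.and (measurableSet_setOfPred.1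
    (measurableSet_lt measurable_const hθ)) (.forall fun n => .forall fun s => .forall fun r =>
    measurableSet_setOfPred.1 (measurableSet_le (hθ.mul_const _) (Measurable.norm ?_))))
  exact Finset.measurable_fun_sum _ fun i _ => (hw i).const_smul
    (if n ≤ i then |(r i : ℝ)| else (r i : ℝ))

theorem measurableSet_nonseparable :
    MeasurableSet {q : CodeSpace d × (ℝ × (ℕ → ℕ → ℝ)) |
      0 < q.2.1 ∧ (∀ n, q.2.2 n ∈ dualBallCodes q.1.1.2.2) ∧
        ∀ n, ∀ U : countableBasis (ℕ → ℝ), q.2.2 n ∈ (U : Set (ℕ → ℝ)) →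
          ∃ m, q.2.2 m ∈ (U : Set (ℕ → ℝ)) ∧ ∃ k, q.2.1 < |q.2.2 n k - q.2.2 m k|} := by
  have hε : Measurable fun q : CodeSpace d × (ℝ × (ℕ → ℕ → ℝ)) => q.2.1 :=
    measurable_fst.comp measurable_snd
  have hu : ∀ n, Measurable fun q : CodeSpace d × (ℝ × (ℕ → ℕ → ℝ)) => q.2.2 n := fun n =>
    (measurable_pi_apply n).comp (measurable_snd.comp measurable_snd)
  have hk : ∀ n k, Measurable fun q : CodeSpace d × (ℝ × (ℕ → ℕ → ℝ)) => q.2.2 n k := fun n k =>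
    (measurable_pi_apply k).comp (hu n)
  have hw : ∀ i, Measurable fun q : CodeSpace d × (ℝ × (ℕ → ℕ → ℝ)) => q.1.1.2.2 i := fun i =>
    (measurable_code_apply i).comp measurable_fst
  have hU : ∀ n, ∀ U : countableBasis (ℕ → ℝ), Measurable
      fun q : CodeSpace d × (ℝ × (ℕ → ℕ → ℝ)) => q.2.2 n ∈ (U : Set (ℕ → ℝ)) := fun n U =>
    measurableSet_setOfPred.1 (hu n (isOpen_of_mem_countableBasis U.2).measurableSet)
  have := (countable_countableBasis (ℕ → ℝ)).to_subtype
  refine measurableSet_setOfPred.2 (.and (measurableSet_setOfPred.1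
    (measurableSet_lt measurable_const hε)) (.and (.forall fun n => .forall fun a => ?_)
    (.forall fun n => .forall fun U => .imp (hU n U) (.exists fun m => .and (hU m U)
      (.exists fun k => measurableSet_setOfPred.1
        (measurableSet_lt hε ((hk n k).sub (hk m k)).abs))))))
  refine measurableSet_setOfPred.1 (measurableSet_le (Measurable.abs ?_) (Measurable.norm ?_))
  · exact Finset.measurable_fun_sum _ fun i _ => (hk n i).const_mul _
  · exact Finset.measurable_fun_sum _ fun i _ => (hw i).const_smul ((a i : ℚ) : ℝ)

end Codes

theorem mainTheorem5 :
    (∃ d : ℕ → SB → CantorC, IsBallSelection d) ∧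
      ∀ (d : ℕ → SB → CantorC) (hd : IsBallSelection d),
        MeasurableSet (codeSet d) ∧
        StandardBorelSpace (CodeSpace d) ∧
        IsCoanalyticSubset (weaklyCompactCodes hd) ∧
        IsCoanalyticSubset (separableAdjointCodes hd) := by
  refine ⟨exists_isBallSelection, fun d hd => ?_⟩
  have hL := hd.measurableSet_codeSet
  have hS : StandardBorelSpace (CodeSpace d) := hL.standardBorel
  refine ⟨hL, hS, ?_, ?_⟩
  · rw [IsCoanalyticSubset]
    convert isAnalyticSubset_exists (measurableSet_tailSeparated (d := d)) using 1
    exact ext (mem_compl_weaklyCompactCodes hd)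
  · rw [IsCoanalyticSubset]
    convert isAnalyticSubset_exists (measurableSet_nonseparable (d := d)) using 1
    exact ext (mem_compl_separableAdjointCodes hd)
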